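/- Let $P$ be a simple polygon with edge set $E$ and let $\delta\colon E\to\mathbb{R}_{\ge 0}$ assign an additive weight to each edge. In the additively-weighted wavefront propagation of $(P,\delta)$ the wavefront at time $0$ is $P$ itself; at time $t$ the wavefront fragments emanated by an edge $e$ lie on the line $\overline{e}+\max(0,t-\delta(e))\,n_e$, where $\overline{e}$ is the supporting line of $e$ and $n_e$ its inward unit normal (so the edge starts to move inwards, self-parallel and at unit speed, at time $\delta(e)$); incidences between wavefront edges are preserved, except that planarity is restored at events: an edge that has shrunk to length zero is removed and its neighbours become adjacent, a wavefront polygon is split where one of its vertices reaches another part of it, and the common portion of parallel edges that have moved into each other is removed. The process ends when all wavefront polygons have collapsed. Let $e(t)$ be the union of the wavefront fragments of $e$ at time $t$. The face of $e$ in the additively-weighted straight skeleton $S(P,\delta)$ is $f(e)=\bigcup_{t\ge 0}e(t)$. It is called monotone with respect to $e$ if every line perpendicular to $\overline{e}$ meets $f(e)$ in a connected (possibly empty) set. A face of an additively-weighted straight skeleton need not be monotone with respect to the edge that emanated it: there exist a simple polygon $P$, additive weights $\delta\colon E\to\mathbb{R}_{\ge 0}$ for which the wavefront propagation exists, and an edge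 $e$ of $P$ such that the face $f(e)$ of $S(P,\delta)$ is not monotone with respect to $e$. -/

import Mathlib

noncomputable section

namespace StraightSkeleton

/-- The Euclidean plane. -/
abbrev Plane : Type := EuclideanSpace ℝ (Fin 2)

/-- A closed polygonal chain whose edges stem from the edges of an `n`-gon, written as the cyclic
list of its vertices. The entry `(e, p)` is a vertex `p` together with the polygon edge `e` that
emanated the chain edge leaving `p`; that chain edge ends at the next vertex of the cyclic list. -/
abbrev Chain (n : ℕ) : Type := List (Fin n × Plane)

variable {n : ℕ}

/-- The edges of a closed chain, as triples (emanating polygon edge, start point, end point). -/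
def chainEdges (c : Chain n) : List (Fin n × Plane × Plane) :=
  List.zipWith (fun v w => (v.1, v.2, w.2)) c (c.rotate 1)

/-- The half-open segment from `p` (included) to `q` (excluded); it is `{p}` if `p = q`. -/
def halfOpenSegment (p q : Plane) : Set Plane :=
  AffineMap.lineMap (k := ℝ) p q '' Set.Ico 0 1

/-- A closed chain is simple if it has at least three edges and runs through no point twice:
its edges, each taken with its start point and without its end point, are pairwise disjoint. -/
def IsSimpleChain (c : Chain n) : Prop :=
  3 ≤ c.length ∧
    (chainEdges c).Pairwise fun g h =>
      Disjoint (halfOpenSegment g.2.1 g.2.2) (halfOpenSegment h.2.1 h.2.2)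

/-- The boundary of a polygon as a closed chain; the edge `i` leads from vertex `i` to the
cyclically next vertex. -/
def inputChain (P : Polygon Plane n) : Chain n :=
  List.ofFn fun i => (i, P i)

/-- `P` is a simple polygon. -/
def IsSimplePolygon (P : Polygon Plane n) : Prop :=
  IsSimpleChain (inputChain P)

/-- The vector from the start to the end of edge `e`. -/
def edgeVector (P : Polygon Plane n) (e : Fin n) : Plane :=
  P (finRotate n e) - P e

/-- Twice the signed area of a polygon (shoelace formula). It is positive for a simple polygon that
is traversed counterclockwise, and negative for one that is traversed clockwise. -/
def signedArea (P : Polygon Plane n) : ℝ :=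
  ∑ i, (P i 0 * P (finRotate n i) 1 - P i 1 * P (finRotate n i) 0)

/-- The unit normal of edge `e` that points into the interior of the simple polygon: the left unit
normal of the edge if the polygon is traversed counterclockwise, the right one otherwise. -/
def inwardNormal (P : Polygon Plane n) (e : Fin n) : Plane :=
  (Real.sign (signedArea P) * ‖edgeVector P e‖⁻¹) • !₂[-(edgeVector P e 1), edgeVector P e 0]

/-- The supporting line at time `t` of the wavefront edges emanated by `e`: the supporting line of
`e` translated by `max 0 (t - δ e)` in the direction of the inward unit normal. -/
def supportLine (P : Polygon Plane n) (δ : Fin n → ℝ) (e : Fin n) (t : ℝ) : Set Plane :=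
  {x | x - max 0 (t - δ e) • inwardNormal P e ∈ line[ℝ, P e, P (finRotate n e)]}

/-- A moving wavefront polygon: a chain whose vertices are functions of time. -/
abbrev MovingChain (n : ℕ) : Type := List (Fin n × (ℝ → Plane))

/-- The position of a moving chain at time `t`. -/
def chainAt (t : ℝ) (m : MovingChain n) : Chain n :=
  m.map fun v => (v.1, v.2 t)

/-- The chain `m` moves as a wavefront polygon during the time interval `[a, b]`, without events in
the open interval `(a, b)`. At each time every edge lies on its supporting line, incidences are
preserved, every vertex moves with constant velocity, and the chain is simple strictly between
`a` and `b`. A vertex is the common point of two supporting lines, which determines its motion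
unless the two edges are parallel; in that case the vertex moves perpendicularly to them (the
velocity lies in the span of their normals). -/
def IsMoving (P : Polygon Plane n) (δ : Fin n → ℝ) (a b : ℝ) (m : MovingChain n) : Prop :=
  (∀ uv ∈ List.zip m (m.rotate 1),
    (∀ t ∈ Set.Icc a b,
      uv.2.2 t ∈ supportLine P δ uv.1.1 t ∧ uv.2.2 t ∈ supportLine P δ uv.2.1 t) ∧
    ∃ w ∈ Submodule.span ℝ {inwardNormal P uv.1.1, inwardNormal P uv.2.1},
      ∀ t ∈ Set.Icc a b, uv.2.2 t = uv.2.2 a + (t - a) • w) ∧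
  ∀ t ∈ Set.Ioo a b, IsSimpleChain (chainAt t m)

/-- `Resolves cs ds`: the list `ds` of simple chains arises from the list `cs` of closed chains by
restoring planarity.
A simple chain is kept. A chain with at most two edges has no interior and is removed. A chain that
visits a point twice, be it at two vertices or at a vertex and in the relative interior of an edge,
is cut there into two closed chains (with `~r` for equality up to the choice of the first vertex).

* Edge event: an edge of length zero is cut off at its two coinciding end points as a chain with one
  edge, which is then removed; its two neighbours become adjacent.
* Split event: a vertex that has reached another part of the chain cuts it into two chains; an edge
  that is hit in its interior contributes a fragment to each of them.
* Parallel edges that have moved into each other are cut at their end points; their common portion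
  forms a chain with two edges, which is removed, and the other portions remain.
* Combinations of these, as in the collapse of a whole chain, are several such steps. -/
inductive Resolves : List (Chain n) → List (Chain n) → Prop
  | nil : Resolves [] []
  | keep {c : Chain n} {cs ds : List (Chain n)} :
      IsSimpleChain c → Resolves cs ds → Resolves (c :: cs) (c :: ds)
  | remove {c : Chain n} {cs ds : List (Chain n)} :
      c.length ≤ 2 → Resolves cs ds → Resolves (c :: cs) ds
  | cutAtVertex {c X Y : Chain n} {cs ds : List (Chain n)} {a b : Fin n} {p : Plane} :
      c ~r ((a, p) :: X ++ (b, p) :: Y) →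
      Resolves (((a, p) :: X) :: ((b, p) :: Y) :: cs) ds → Resolves (c :: cs) ds
  | cutAtEdge {c X Y : Chain n} {cs ds : List (Chain n)} {a b d : Fin n} {p q r : Plane} :
      c ~r ((a, p) :: X ++ (b, q) :: (d, r) :: Y) → p ∈ openSegment ℝ q r →
      Resolves (((a, p) :: X ++ [(b, q)]) :: ((b, p) :: (d, r) :: Y) :: cs) ds →
      Resolves (c :: cs) ds

/-- The additively-weighted wavefront propagation of `P`
with additive weights `δ`: finitely many phases `[time k, time (k + 1)]`, starting at time zero with
the polygon itself. During a phase the wavefront polygons `phase k` move without events, at the end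
of a phase planarity is restored, and the process ends when all wavefront polygons have collapsed.
Speed-change events also separate phases, since vertices have constant velocity in a phase. -/
structure Propagation (P : Polygon Plane n) (δ : Fin n → ℝ) where
  /-- the number of phases -/
  steps : ℕ
  /-- the start times of the phases; `time steps` is the end of the process -/
  time : ℕ → ℝ
  /-- the wavefront polygons in each phase -/
  phase : ℕ → List (MovingChain n)
  time_zero : time 0 = 0
  time_lt : ∀ k < steps, time k < time (k + 1)
  start : (phase 0).map (chainAt 0) = [inputChain P]
  moving : ∀ k < steps, ∀ m ∈ phase k, IsMoving P δ (time k) (time (k + 1)) m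
  resolves : ∀ k < steps,
    Resolves ((phase k).map (chainAt (time (k + 1)))) ((phase (k + 1)).map (chainAt (time (k + 1))))
  collapsed : phase steps = []

/-- The union `e(t)` of the wavefront fragments at time `t` that are emanated by the edge `e`. (At
the time of an event this includes the fragments as they arrive at the event.) -/
def Propagation.fragments {P : Polygon Plane n} {δ : Fin n → ℝ} (W : Propagation P δ)
    (e : Fin n) (t : ℝ) : Set Plane :=
  {x | ∃ k < W.steps, t ∈ Set.Icc (W.time k) (W.time (k + 1)) ∧
    ∃ m ∈ W.phase k, ∃ g ∈ chainEdges (chainAt t m), g.1 = e ∧ x ∈ segment ℝ g.2.1 g.2.2}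

/-- The face `f(e)` of the edge `e`: the region traced out by the fragments of `e` over time. -/
def Propagation.face {P : Polygon Plane n} {δ : Fin n → ℝ} (W : Propagation P δ)
    (e : Fin n) : Set Plane :=
  ⋃ t ≥ (0 : ℝ), W.fragments e t

/-- A planar set is monotone with respect to a line of direction `d` if each line perpendicular to
it meets the set in a connected (possibly empty) set. -/
def IsMonotoneWrt (S : Set Plane) (d : Plane) : Prop :=
  ∀ x : Plane, IsPreconnected (S ∩ {y | inner ℝ (y - x) d = 0})

end StraightSkeleton

end

/-!
The witness is a quadrilateral with a reflex vertex at the origin, between the horizontal edge `0`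
and edge `3`. Edge `0` moves upwards from the start and edge `3` only from time `1`, so the reflex
vertex moves with velocity `(4/3, 1)` until time `1` and with velocity `(-1/3, 1)` afterwards. On
the line `x = 1`, the fragments of edge `0` sweep the point at height `0`, have left the line at
time `1`, when they start at `x = 4/3`, and are back at time `2`. Since the fragments at time `t`
lie at height `t`, the face meets this line in a disconnected set.

This holds for every propagation. A vertex motion is determined by its start: the difference of two
motions is orthogonal to the normals of both edges, and it lies in their span. As long as the
resulting chain is simple, restoring planarity leaves it unchanged, whatever the times at which it
takes place.
-/

namespace StraightSkeleton

open Set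

variable {n : ℕ} {P : Polygon Plane n} {δ : Fin n → ℝ}

theorem plane_ext {p q : Plane} (h0 : p 0 = q 0) (h1 : p 1 = q 1) : p = q :=
  PiLp.ext (Fin.forall_fin_two.2 ⟨h0, h1⟩)

/-- The planar cross product of `v` and `w`, as a linear form in `w`: the signed area of the
parallelogram that they span, which is positive if `w` points to the left of `v`. -/
def cross (v : Plane) : Plane →ₗ[ℝ] ℝ where
  toFun w := v 0 * w 1 - v 1 * w 0
  map_add' _ _ := by simp only [PiLp.add_apply]; ring
  map_smul' _ _ := by simp only [PiLp.smul_apply, smul_eq_mul, RingHom.id_apply]; ring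

theorem cross_apply (v w : Plane) : cross v w = v 0 * w 1 - v 1 * w 0 := rfl

theorem cross_eq_zero_iff_exists_smul_eq {v w : Plane} (hv : v ≠ 0) :
    cross v w = 0 ↔ ∃ r : ℝ, r • v = w := by
  constructor
  · intro h
    have hv2 : v 0 ^ 2 + v 1 ^ 2 ≠ 0 := by
      rwa [← Fin.sum_univ_two (fun i => v i ^ 2), ← EuclideanSpace.real_norm_sq_eq,
        pow_ne_zero_iff two_ne_zero, norm_ne_zero_iff]
    rw [cross_apply] at h
    refine ⟨(v 0 * w 0 + v 1 * w 1) / (v 0 ^ 2 + v 1 ^ 2), plane_ext ?_ ?_⟩ <;>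
      simp only [PiLp.smul_apply, smul_eq_mul] <;> field_simp
    · linear_combination v 1 * h
    · linear_combination -v 0 * h
  · rintro ⟨r, rfl⟩
    simp only [cross_apply, PiLp.smul_apply, smul_eq_mul]
    ring

theorem eq_zero_of_cross_eq_zero {v w x : Plane} (hvw : cross v w ≠ 0) (hv : cross v x = 0)
    (hw : cross w x = 0) : x = 0 := by
  simp only [cross_apply] at hvw hv hw
  apply plane_ext <;> apply (mul_eq_zero.1 _).resolve_left hvw
  · linear_combination w 0 * hv - v 0 * hw
  · linear_combination w 1 * hv - v 1 * hw

theorem mem_line_iff_cross_eq_zero {p q x : Plane} (hpq : p ≠ q) :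
    x ∈ line[ℝ, p, q] ↔ cross (q - p) (x - p) = 0 := by
  rw [cross_eq_zero_iff_exists_smul_eq (sub_ne_zero.2 hpq.symm),
    mem_affineSpan_pair_iff_exists_lineMap_eq]
  simp only [AffineMap.lineMap_apply, vsub_eq_sub, vadd_eq_add, eq_sub_iff_add_eq]

theorem inner_inwardNormal (P : Polygon Plane n) (e : Fin n) (x : Plane) :
    inner ℝ (inwardNormal P e) x =
      Real.sign (signedArea P) * ‖edgeVector P e‖⁻¹ * cross (edgeVector P e) x := by
  rw [inwardNormal, real_inner_smul_left]
  congr 1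
  simp only [PiLp.inner_apply, Fin.sum_univ_two, cross_apply, RCLike.inner_apply, conj_trivial]
  simp
  ring

theorem cross_edgeVector_inwardNormal (P : Polygon Plane n) (e : Fin n) :
    cross (edgeVector P e) (inwardNormal P e) =
      Real.sign (signedArea P) * ‖edgeVector P e‖ := by
  have hself : cross (edgeVector P e) !₂[-(edgeVector P e 1), edgeVector P e 0] =
      ‖edgeVector P e‖ ^ 2 := by
    rw [EuclideanSpace.real_norm_sq_eq, Fin.sum_univ_two, cross_apply]
    simp
    ring
  rw [inwardNormal, map_smul, hself, smul_eq_mul, mul_assoc, pow_two, ← mul_assoc ‖_‖⁻¹,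
    inv_mul_mul_self]

theorem mem_supportLine_iff {e : Fin n} (he : edgeVector P e ≠ 0) {t : ℝ} {x : Plane} :
    x ∈ supportLine P δ e t ↔ cross (edgeVector P e) (x - P e) =
      Real.sign (signedArea P) * ‖edgeVector P e‖ * max 0 (t - δ e) := by
  rw [supportLine, mem_ofPred_eq, mem_line_iff_cross_eq_zero (sub_ne_zero.1 he).symm, ← edgeVector,
    sub_right_comm, map_sub, map_smul, cross_edgeVector_inwardNormal, smul_eq_mul, sub_eq_zero,
    mul_comm (max _ _)]

theorem inner_inwardNormal_sub_of_mem_supportLine (hP : signedArea P ≠ 0) {e : Fin n}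
    (he : edgeVector P e ≠ 0) {t : ℝ} {x : Plane} (hx : x ∈ supportLine P δ e t) :
    inner ℝ (inwardNormal P e) (x - P e) = max 0 (t - δ e) := by
  have hsign : Real.sign (signedArea P) * Real.sign (signedArea P) = 1 := by
    rcases Real.sign_apply_eq_of_ne_zero _ hP with h | h <;> simp [h]
  rw [inner_inwardNormal, (mem_supportLine_iff he).1 hx]
  have := norm_ne_zero_iff.2 he
  field_simp
  rw [pow_two, hsign, one_mul]

theorem inner_inwardNormal_sub_eq_zero {e : Fin n} {t : ℝ} {x y : Plane}
    (hx : x ∈ supportLine P δ e t) (hy : y ∈ supportLine P δ e t) :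
    inner ℝ (inwardNormal P e) (x - y) = 0 := by
  rcases eq_or_ne (edgeVector P e) 0 with he | he
  · rw [inner_inwardNormal, he, norm_zero, inv_zero, mul_zero, zero_mul]
  · rw [inner_inwardNormal, ← sub_sub_sub_cancel_right x y (P e), map_sub,
      (mem_supportLine_iff he).1 hx, (mem_supportLine_iff he).1 hy, sub_self, mul_zero]

theorem eq_of_mem_supportLine_of_sub_mem_span {d e : Fin n} {t : ℝ} {x y : Plane}
    (hxd : x ∈ supportLine P δ d t) (hyd : y ∈ supportLine P δ d t)
    (hxe : x ∈ supportLine P δ e t) (hye : y ∈ supportLine P δ e t)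
    (hxy : x - y ∈ Submodule.span ℝ {inwardNormal P d, inwardNormal P e}) : x = y := by
  obtain ⟨r, s, hrs⟩ := Submodule.mem_span_pair.1 hxy
  rw [← sub_eq_zero, ← inner_self_eq_zero (𝕜 := ℝ)]
  nth_rw 1 [← hrs]
  rw [inner_add_left, real_inner_smul_left, real_inner_smul_left,
    inner_inwardNormal_sub_eq_zero hxd hyd, inner_inwardNormal_sub_eq_zero hxe hye, mul_zero,
    mul_zero, add_zero]

theorem convex_supportLine (P : Polygon Plane n) (δ : Fin n → ℝ) (e : Fin n) (t : ℝ) :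
    Convex ℝ (supportLine P δ e t) := by
  have h := (line[ℝ, P e, P (finRotate n e)]).convex.translate_preimage_left
    (-(max 0 (t - δ e) • inwardNormal P e))
  simp only [← sub_eq_add_neg] at h
  exact h

theorem span_inwardNormal_pair_eq_top (hP : signedArea P ≠ 0) {d e : Fin n}
    (hde : cross (edgeVector P d) (edgeVector P e) ≠ 0) :
    Submodule.span ℝ {inwardNormal P d, inwardNormal P e} = ⊤ := by
  have hd : edgeVector P d ≠ 0 := by rintro h; simp [h, cross_apply] at hde
  have he : edgeVector P e ≠ 0 := by rintro h; simp [h] at hde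
  rw [← Submodule.orthogonal_eq_bot_iff, Submodule.eq_bot_iff]
  intro x hx
  have hcross {i : Fin n} (hi : edgeVector P i ≠ 0)
      (hmem : inwardNormal P i ∈ Submodule.span ℝ {inwardNormal P d, inwardNormal P e}) :
      cross (edgeVector P i) x = 0 := by
    have h := Submodule.inner_right_of_mem_orthogonal hmem hx
    rw [inner_inwardNormal] at h
    exact (mul_eq_zero.1 h).resolve_left
      (mul_ne_zero (Real.sign_eq_zero_iff.not.2 hP) (inv_ne_zero (norm_ne_zero_iff.2 hi)))
  exact eq_zero_of_cross_eq_zero hde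
    (hcross hd (Submodule.subset_span (by simp))) (hcross he (Submodule.subset_span (by simp)))

theorem segment_horizontal {a b c : ℝ} (hab : a ≤ b) :
    segment ℝ (!₂[a, c] : Plane) !₂[b, c] = {x | x 0 ∈ Icc a b ∧ x 1 = c} := by
  ext x
  rw [← segment_eq_Icc hab]
  constructor
  · rintro ⟨r, s, hr, hs, hrs, rfl⟩
    exact ⟨⟨r, s, hr, hs, hrs, by simp⟩, by simp [← add_mul, hrs]⟩
  · rintro ⟨⟨r, s, hr, hs, hrs, hx⟩, hc⟩
    exact ⟨r, s, hr, hs, hrs, plane_ext (by simpa using hx) (by simp [← add_mul, hrs, hc])⟩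

theorem left_mem_halfOpenSegment (p q : Plane) : p ∈ halfOpenSegment p q :=
  ⟨0, by simp, by simp⟩

theorem openSegment_subset_halfOpenSegment (p q : Plane) :
    openSegment ℝ p q ⊆ halfOpenSegment p q := by
  rw [openSegment_eq_image_lineMap]
  exact image_mono Ioo_subset_Ico_self

theorem disjoint_halfOpenSegment_of_cross_lt {v p q r s : Plane} {c : ℝ} (hp : cross v p ≤ c)
    (hq : cross v q ≤ c) (hr : c < cross v r) (hs : c ≤ cross v s) :
    Disjoint (halfOpenSegment p q) (halfOpenSegment r s) := by
  have hcross (x y : Plane) (a : ℝ) :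
      cross v (AffineMap.lineMap x y a) = (1 - a) * cross v x + a * cross v y := by
    rw [AffineMap.lineMap_apply_module, map_add, map_smul, map_smul, smul_eq_mul, smul_eq_mul]
  rw [disjoint_left]
  rintro _ ⟨a, ⟨ha0, ha1⟩, rfl⟩ ⟨b, ⟨hb0, hb1⟩, hab⟩
  have heq := congrArg (cross v) hab
  rw [hcross, hcross] at heq
  have hle : (1 - a) * cross v p + a * cross v q ≤ c :=
    (convex_Iic c) hp hq (sub_nonneg.2 ha1.le) ha0 (sub_add_cancel 1 a)
  have hlt : c < (1 - b) * cross v r + b * cross v s := by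
    nlinarith [mul_pos (sub_pos.2 hb1) (sub_pos.2 hr), mul_nonneg hb0 (sub_nonneg.2 hs)]
  exact hlt.not_ge (heq.trans_le hle)

theorem chainEdges_rotate (c : Chain n) (k : ℕ) :
    chainEdges (c.rotate k) = (chainEdges c).rotate k := by
  rw [chainEdges, chainEdges, List.zipWith_rotate_distrib _ _ _ _ (List.length_rotate ..).symm,
    List.rotate_rotate, List.rotate_rotate, add_comm]

theorem chainEdges_append (u v : Fin n × Plane) (X Y : Chain n) :
    chainEdges (u :: X ++ v :: Y) =
      List.zipWith (fun v w => (v.1, v.2, w.2)) (u :: X) (X ++ [v]) ++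
        List.zipWith (fun v w => (v.1, v.2, w.2)) (v :: Y) (Y ++ [u]) := by
  rw [← List.zipWith_append (by simp)]
  simp [chainEdges]

theorem isSimpleChain_quadrilateral {i j k l : Fin n} {p q r s : Plane}
    (hpqr : 0 < cross (r - q) (p - q)) (hqrs : 0 < cross (s - r) (q - r))
    (hrsp : 0 < cross (p - s) (r - s)) :
    IsSimpleChain [(i, p), (j, q), (k, r), (l, s)] := by
  refine ⟨by simp, ?_⟩
  simp only [chainEdges, List.rotate_cons_succ, List.rotate_zero, List.cons_append,
    List.nil_append, List.zipWith_cons_cons, List.zipWith_nil_left, List.pairwise_cons,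
    List.mem_cons, List.not_mem_nil, or_false, forall_eq_or_imp, forall_eq, List.Pairwise.nil,
    and_true, false_imp_iff, implies_true]
  simp only [cross_apply, PiLp.sub_apply] at hpqr hqrs hrsp
  -- Separating lines: an edge line each time, except the diagonal `pr` for the edges at `p`.
  refine ⟨⟨.symm ?_, .symm ?_, ?_⟩, ⟨.symm ?_, ?_⟩, .symm ?_⟩
  · apply disjoint_halfOpenSegment_of_cross_lt (v := r - q) (c := cross (r - q) q)
    all_goals simp only [cross_apply, PiLp.sub_apply]; linarith
  · apply disjoint_halfOpenSegment_of_cross_lt (v := s - r) (c := cross (s - r) r)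
    all_goals simp only [cross_apply, PiLp.sub_apply]; linarith
  · apply disjoint_halfOpenSegment_of_cross_lt (v := r - p) (c := cross (r - p) p)
    all_goals simp only [cross_apply, PiLp.sub_apply]; linarith
  · apply disjoint_halfOpenSegment_of_cross_lt (v := s - r) (c := cross (s - r) r)
    all_goals simp only [cross_apply, PiLp.sub_apply]; linarith
  · apply disjoint_halfOpenSegment_of_cross_lt (v := r - q) (c := cross (r - q) q)
    all_goals simp only [cross_apply, PiLp.sub_apply]; linarith
  · apply disjoint_halfOpenSegment_of_cross_lt (v := p - s) (c := cross (p - s) s)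
    all_goals simp only [cross_apply, PiLp.sub_apply]; linarith

theorem IsSimpleChain.of_isRotated {c d : Chain n} (hc : IsSimpleChain c) (h : c ~r d) :
    IsSimpleChain d := by
  obtain ⟨k, rfl⟩ := h
  refine ⟨by simpa using hc.1, ?_⟩
  rw [chainEdges_rotate]
  exact ((List.rotate_perm _ k).pairwise_iff (fun h => h.symm)).2 hc.2

theorem IsSimpleChain.disjoint_halfOpenSegment {u v : Fin n × Plane} {X Y : Chain n}
    (h : IsSimpleChain (u :: X ++ v :: Y)) :
    Disjoint (halfOpenSegment u.2 ((X ++ [v]).head (by simp)).2)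
      (halfOpenSegment v.2 ((Y ++ [u]).head (by simp)).2) := by
  have hpair := h.2
  rw [chainEdges_append, List.pairwise_append] at hpair
  refine hpair.2.2 (u.1, u.2, _) ?_ (v.1, v.2, _) ?_
  · cases X <;> simp
  · cases Y <;> simp

theorem not_isSimpleChain_of_repeated_vertex {a b : Fin n} {p : Plane} {X Y : Chain n} :
    ¬ IsSimpleChain ((a, p) :: X ++ (b, p) :: Y) := fun h =>
  disjoint_left.1 h.disjoint_halfOpenSegment (left_mem_halfOpenSegment p _)
    (left_mem_halfOpenSegment p _)

theorem not_isSimpleChain_of_vertex_mem_edge {a b d : Fin n} {p q r : Plane} {X Y : Chain n}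
    (hp : p ∈ openSegment ℝ q r) :
    ¬ IsSimpleChain ((a, p) :: X ++ (b, q) :: (d, r) :: Y) := fun h =>
  disjoint_left.1 h.disjoint_halfOpenSegment (left_mem_halfOpenSegment p _)
    (openSegment_subset_halfOpenSegment q r hp)

theorem Resolves.eq_of_forall_isSimpleChain {cs ds : List (Chain n)} (h : Resolves cs ds)
    (hcs : ∀ c ∈ cs, IsSimpleChain c) : ds = cs := by
  induction h with
  | nil => rfl
  | keep _ _ ih => rw [ih fun c hc => hcs c (List.mem_cons_of_mem _ hc)]
  | remove hlen _ _ =>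
    have h3 := (hcs _ List.mem_cons_self).1
    lia
  | cutAtVertex hrot _ _ =>
    exact (not_isSimpleChain_of_repeated_vertex
      ((hcs _ List.mem_cons_self).of_isRotated hrot)).elim
  | cutAtEdge hrot hp _ _ =>
    exact (not_isSimpleChain_of_vertex_mem_edge hp
      ((hcs _ List.mem_cons_self).of_isRotated hrot)).elim

theorem chainEdges_chainAt (t : ℝ) (m : MovingChain n) :
    chainEdges (chainAt t m) =
      (List.zip m (m.rotate 1)).map fun uv => (uv.1.1, uv.1.2 t, uv.2.2 t) := by
  rw [chainEdges, chainAt, ← List.map_rotate, List.zipWith_map, List.zip, List.map_zipWith]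

/-- The geometric part of `IsMoving`: each vertex of `m` stays on the supporting lines of its two
edges and is displaced only within the span of their normals. Unlike in `IsMoving`, velocities may
change, so that one moving chain can describe several phases. -/
def FollowsSupportLines (P : Polygon Plane n) (δ : Fin n → ℝ) (a b : ℝ) (m : MovingChain n) :
    Prop :=
  ∀ uv ∈ List.zip m (m.rotate 1), ∀ t ∈ Icc a b,
    uv.2.2 t ∈ supportLine P δ uv.1.1 t ∧ uv.2.2 t ∈ supportLine P δ uv.2.1 t ∧
      uv.2.2 t - uv.2.2 a ∈ Submodule.span ℝ {inwardNormal P uv.1.1, inwardNormal P uv.2.1}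

theorem IsMoving.followsSupportLines {a b : ℝ} {m : MovingChain n} (hm : IsMoving P δ a b m) :
    FollowsSupportLines P δ a b m := by
  intro uv huv t ht
  obtain ⟨hline, w, hw, hmove⟩ := hm.1 uv huv
  refine ⟨(hline t ht).1, (hline t ht).2, ?_⟩
  rw [hmove t ht, add_sub_cancel_left]
  exact Submodule.smul_mem _ _ hw

namespace FollowsSupportLines

variable {a b s t : ℝ} {m m' : MovingChain n}

theorem mono (hm : FollowsSupportLines P δ a b m) (has : a ≤ s) (htb : t ≤ b) :
    FollowsSupportLines P δ s t m := by
  intro uv huv r hr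
  obtain ⟨hu, hv, hr0⟩ := hm uv huv r ⟨has.trans hr.1, hr.2.trans htb⟩
  have hs0 := (hm uv huv s ⟨has, (hr.1.trans hr.2).trans htb⟩).2.2
  exact ⟨hu, hv, by simpa only [sub_sub_sub_cancel_right] using Submodule.sub_mem _ hr0 hs0⟩

theorem isMoving (hm : FollowsSupportLines P δ a b m) (hab : a < b)
    (hvel : ∀ v ∈ m, ∃ w, ∀ t ∈ Icc a b, v.2 t = v.2 a + (t - a) • w)
    (hsimple : ∀ t ∈ Ioo a b, IsSimpleChain (chainAt t m)) : IsMoving P δ a b m := by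
  refine ⟨fun uv huv => ⟨fun t ht => ⟨(hm uv huv t ht).1, (hm uv huv t ht).2.1⟩, ?_⟩, hsimple⟩
  obtain ⟨w, hw⟩ := hvel uv.2 (List.mem_rotate.1 (List.of_mem_zip huv).2)
  have hspan := (hm uv huv b (right_mem_Icc.2 hab.le)).2.2
  rw [hw b (right_mem_Icc.2 hab.le), add_sub_cancel_left,
    Submodule.smul_mem_iff _ (sub_ne_zero.2 hab.ne')] at hspan
  exact ⟨w, hspan, hw⟩

theorem mem_supportLine_of_mem_chainEdges (hm : FollowsSupportLines P δ a b m) (ht : t ∈ Icc a b)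
    {g : Fin n × Plane × Plane} (hg : g ∈ chainEdges (chainAt t m)) :
    g.2.1 ∈ supportLine P δ g.1 t ∧ g.2.2 ∈ supportLine P δ g.1 t := by
  rw [chainEdges_chainAt] at hg
  obtain ⟨⟨u, v⟩, huv, rfl⟩ := List.mem_map.1 hg
  refine ⟨?_, (hm _ huv t ht).1⟩
  have hu : u ∈ (List.zip m (m.rotate 1)).map Prod.snd := by
    rw [List.map_snd_zip (List.length_rotate ..).le]
    exact List.mem_rotate.2 (List.of_mem_zip huv).1
  obtain ⟨⟨_, _⟩, hmem, rfl⟩ := List.mem_map.1 hu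
  exact (hm _ hmem t ht).2.1

theorem chainAt_eq (hm : FollowsSupportLines P δ a b m) (hm' : FollowsSupportLines P δ a b m')
    (h : chainAt a m = chainAt a m') (ht : t ∈ Icc a b) : chainAt t m = chainAt t m' := by
  have hlen : m.length = m'.length := by simpa [chainAt] using congrArg List.length h
  have hvertex {l l' : MovingChain n} (hl : chainAt a l = chainAt a l') {i : ℕ}
      (hi : i < l.length) (hi' : i < l'.length) : l[i].1 = l'[i].1 ∧ l[i].2 a = l'[i].2 a := by
    have := List.getElem_of_eq hl (i := i) (by simpa [chainAt] using hi)
    simpa [chainAt, Prod.ext_iff] using this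
  have hrot : chainAt a (m.rotate 1) = chainAt a (m'.rotate 1) := by
    simpa only [chainAt, List.map_rotate] using congrArg (List.rotate · 1) h
  suffices chainAt t (m.rotate 1) = chainAt t (m'.rotate 1) by
    simpa only [chainAt, List.map_rotate, List.rotate_eq_rotate] using this
  refine List.ext_getElem (by simp [chainAt, hlen]) fun i hi hi' => ?_
  simp only [chainAt, List.length_map, List.length_rotate] at hi hi'
  have hlt : i < (m.rotate 1).length := by simpa using hi
  have hlt' : i < (m'.rotate 1).length := by simpa using hi'
  obtain ⟨hu, hv, hd⟩ := hm (m[i], (m.rotate 1)[i])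
    (List.mem_iff_getElem.2 ⟨i, by simpa using hi, by simp⟩) t ht
  obtain ⟨hu', hv', hd'⟩ := hm' (m'[i], (m'.rotate 1)[i])
    (List.mem_iff_getElem.2 ⟨i, by simpa using hi', by simp⟩) t ht
  obtain ⟨hprev, -⟩ := hvertex h hi hi'
  obtain ⟨hlabel, hstart⟩ := hvertex hrot hlt hlt'
  simp only [← hprev, ← hlabel, ← hstart] at hu' hv' hd'
  have hspan := Submodule.sub_mem _ hd hd'
  rw [sub_sub_sub_cancel_right] at hspan
  simp only [chainAt, List.getElem_map]
  exact Prod.ext hlabel (eq_of_mem_supportLine_of_sub_mem_span hu hu' hv hv' hspan)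

end FollowsSupportLines

/-- `m` describes the wavefront of `(P, δ)` until the time `T` of its first event. Changes of
velocity do not count as events here. -/
structure IsWavefrontUntil (P : Polygon Plane n) (δ : Fin n → ℝ) (T : ℝ) (m : MovingChain n) :
    Prop where
  start : chainAt 0 m = inputChain P
  followsSupportLines : FollowsSupportLines P δ 0 T m
  isSimpleChain : ∀ t ∈ Ico 0 T, IsSimpleChain (chainAt t m)

theorem IsWavefrontUntil.isMoving {T a b : ℝ} {m : MovingChain n} (hm : IsWavefrontUntil P δ T m)
    (ha : 0 ≤ a) (hab : a < b) (hb : b ≤ T)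
    (hvel : ∀ v ∈ m, ∃ w, ∀ t ∈ Icc a b, v.2 t = v.2 a + (t - a) • w) : IsMoving P δ a b m :=
  (hm.followsSupportLines.mono ha hb).isMoving hab hvel fun t ht =>
    hm.isSimpleChain t ⟨ha.trans ht.1.le, ht.2.trans_le hb⟩

namespace Propagation

variable (W : Propagation P δ) {T t : ℝ} {m : MovingChain n} {k : ℕ} {e : Fin n}

theorem time_nonneg (hk : k ≤ W.steps) : 0 ≤ W.time k := by
  induction k with
  | zero => exact W.time_zero.ge
  | succ k ih => exact (ih (by lia)).trans (W.time_lt k (by lia)).le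

theorem exists_mem_Icc_time (h0 : 0 ≤ t) (ht : t < W.time W.steps) :
    ∃ k < W.steps, t ∈ Icc (W.time k) (W.time (k + 1)) := by
  classical
  let k := Nat.findGreatest (fun k => W.time k ≤ t) W.steps
  have hk : W.time k ≤ t :=
    Nat.findGreatest_spec (P := fun k => W.time k ≤ t) (Nat.zero_le _) (W.time_zero.trans_le h0)
  have hne : k ≠ W.steps := fun h => (h ▸ ht.not_ge : ¬ W.time k ≤ t) hk
  have hlt : k < W.steps := (Nat.findGreatest_le _).lt_of_ne hne
  have hnext : ¬ W.time (k + 1) ≤ t := Nat.findGreatest_is_greatest (Nat.lt_succ_self k) hlt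
  exact ⟨k, hlt, hk, (not_le.1 hnext).le⟩

theorem mem_supportLine_of_mem_fragments {x : Plane} (hx : x ∈ W.fragments e t) :
    x ∈ supportLine P δ e t := by
  obtain ⟨k, hk, ht, m, hm, g, hg, rfl, hx⟩ := hx
  obtain ⟨hstart, hend⟩ :=
    (W.moving k hk m hm).followsSupportLines.mem_supportLine_of_mem_chainEdges ht hg
  exact (convex_supportLine P δ g.1 t).segment_subset hstart hend hx

theorem fragments_subset_face (e : Fin n) (t : ℝ) : W.fragments e t ⊆ W.face e := by
  rintro x hx
  obtain ⟨k, hk, ht, -⟩ := id hx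
  exact mem_iUnion₂.2 ⟨t, (W.time_nonneg hk.le).trans ht.1, hx⟩

/-- The fragments of `e` at time `t` lie at height `t - δ e` above `e`, so the height on a
perpendicular line cannot pass continuously through the level of a time at which the line misses
the fragments. -/
theorem not_isMonotoneWrt_face (hP : signedArea P ≠ 0) (he : edgeVector P e ≠ 0) {x : Plane}
    {s u : ℝ} (hst : s ≤ t) (htu : t ≤ u) (het : δ e < t)
    (hs : (W.fragments e s ∩ {y | inner ℝ (y - x) (edgeVector P e) = 0}).Nonempty)
    (ht : W.fragments e t ∩ {y | inner ℝ (y - x) (edgeVector P e) = 0} = ∅)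
    (hu : (W.fragments e u ∩ {y | inner ℝ (y - x) (edgeVector P e) = 0}).Nonempty) :
    ¬ IsMonotoneWrt (W.face e) (edgeVector P e) := by
  intro hmono
  let height (y : Plane) : ℝ := inner ℝ (inwardNormal P e) (y - P e)
  have hheight {r : ℝ} {y : Plane} (hy : y ∈ W.fragments e r) : height y = max 0 (r - δ e) :=
    inner_inwardNormal_sub_of_mem_supportLine hP he (W.mem_supportLine_of_mem_fragments hy)
  have hconn := (hmono x).image height (by fun_prop)
  obtain ⟨y, hy, hyx⟩ := hs
  obtain ⟨z, hz, hzx⟩ := hu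
  have hlevel : max 0 (t - δ e) ∈ Icc (height y) (height z) := by
    rw [hheight hy, hheight hz]
    exact ⟨by gcongr, by gcongr⟩
  obtain ⟨w, ⟨hw, hwx⟩, hwt⟩ := hconn.Icc_subset
    (mem_image_of_mem _ ⟨W.fragments_subset_face e s hy, hyx⟩)
    (mem_image_of_mem _ ⟨W.fragments_subset_face e u hz, hzx⟩) hlevel
  obtain ⟨r, -, hwr⟩ := mem_iUnion₂.1 hw
  have hrt : r = t := by
    rw [hheight hwr, max_eq_right (sub_pos.2 het).le] at hwt
    rcases max_cases 0 (r - δ e) with h | h <;> linarith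
  exact (ht ▸ ⟨hrt ▸ hwr, hwx⟩ : w ∈ (∅ : Set Plane))

variable {W}

theorem map_chainAt_phase (hm : IsWavefrontUntil P δ T m) (hk : k ≤ W.steps) (hT : W.time k < T) :
    (W.phase k).map (chainAt (W.time k)) = [chainAt (W.time k) m] := by
  induction k with
  | zero => rw [W.time_zero, W.start, hm.start]
  | succ k ih =>
    have hlt := W.time_lt k hk
    obtain ⟨m', hphase, hpos⟩ := List.map_eq_singleton_iff.1 (ih (by lia) (hlt.trans hT))
    have hmove : chainAt (W.time (k + 1)) m' = chainAt (W.time (k + 1)) m :=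
      (W.moving k hk m' (by simp [hphase])).followsSupportLines.chainAt_eq
        (hm.followsSupportLines.mono (W.time_nonneg (by lia)) hT.le) hpos ⟨hlt.le, le_rfl⟩
    have hres := W.resolves k hk
    rw [hphase, List.map_singleton, hmove] at hres
    refine hres.eq_of_forall_isSimpleChain fun c hc => ?_
    rw [List.mem_singleton.1 hc]
    exact hm.isSimpleChain _ ⟨W.time_nonneg hk, hT⟩

theorem exists_phase_eq_singleton (hm : IsWavefrontUntil P δ T m) (hk : k < W.steps)
    (ht : t ∈ Icc (W.time k) (W.time (k + 1))) (hT : t < T) :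
    ∃ m', W.phase k = [m'] ∧ chainAt t m' = chainAt t m := by
  obtain ⟨m', hphase, hpos⟩ :=
    List.map_eq_singleton_iff.1 (map_chainAt_phase hm hk.le (ht.1.trans_lt hT))
  have hmove := (W.moving k hk m' (by simp [hphase])).followsSupportLines.mono le_rfl ht.2
  exact ⟨m', hphase, hmove.chainAt_eq
    (hm.followsSupportLines.mono (W.time_nonneg hk.le) hT.le) hpos ⟨ht.1, le_rfl⟩⟩

theorem le_time_steps (hm : IsWavefrontUntil P δ T m) : T ≤ W.time W.steps := by
  by_contra! hT
  simpa [W.collapsed] using map_chainAt_phase hm le_rfl hT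

theorem mem_fragments_iff (hm : IsWavefrontUntil P δ T m) (h0 : 0 ≤ t) (hT : t < T) {x : Plane} :
    x ∈ W.fragments e t ↔
      ∃ g ∈ chainEdges (chainAt t m), g.1 = e ∧ x ∈ segment ℝ g.2.1 g.2.2 := by
  constructor
  · rintro ⟨k, hk, ht, m', hm', hx⟩
    obtain ⟨m'', hphase, hpos⟩ := exists_phase_eq_singleton hm hk ht hT
    obtain rfl : m' = m'' := by simpa [hphase] using hm'
    rwa [hpos] at hx
  · intro hx
    obtain ⟨k, hk, ht⟩ := W.exists_mem_Icc_time h0 (hT.trans_le (le_time_steps hm))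
    obtain ⟨m', hphase, hpos⟩ := exists_phase_eq_singleton hm hk ht hT
    exact ⟨k, hk, ht, m', by simp [hphase], by rwa [hpos]⟩

end Propagation

/-- A nonconvex quadrilateral with its reflex vertex at the origin, the start of edge `0`. -/
def dart : Polygon Plane 4 := ⟨![!₂[0, 0], !₂[5, 0], !₂[0, 5], !₂[-4, -3]]⟩

/-- The additive weights of the edges of `dart`: edges `1` and `2` rest until the collapse. -/
def dartWeight : Fin 4 → ℝ := ![0, 5, 5, 1]

/-- The wavefront of `dart` up to its collapse at time `5`. -/
noncomputable def dartWavefront : MovingChain 4 :=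
  [(0, fun t => !₂[(4 * t - 5 * max 0 (t - 1)) / 3, t]), (1, fun t => !₂[5 - t, t]),
    (2, fun _ => !₂[0, 5]), (3, fun t => !₂[max 0 (t - 1) - 4, 2 * max 0 (t - 1) - 3])]

theorem dart_apply (e : Fin 4) : dart e = ![!₂[0, 0], !₂[5, 0], !₂[0, 5], !₂[-4, -3]] e := rfl

theorem edgeVector_dart : edgeVector dart = ![!₂[5, 0], !₂[-5, 5], !₂[-4, -8], !₂[4, 3]] := by
  funext e
  fin_cases e <;> apply plane_ext <;>
    simp [edgeVector, dart_apply, finRotate_apply]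
  all_goals norm_num

theorem signedArea_dart : signedArea dart = 45 := by
  simp [signedArea, Fin.sum_univ_four, dart_apply, finRotate_apply]
  norm_num

theorem norm_edgeVector_dart_zero : ‖edgeVector dart 0‖ = 5 := by
  simp [edgeVector_dart, EuclideanSpace.norm_eq, Fin.sum_univ_two]

theorem norm_edgeVector_dart_three : ‖edgeVector dart 3‖ = 5 := by
  rw [← sq_eq_sq₀ (norm_nonneg _) (by norm_num), EuclideanSpace.real_norm_sq_eq, Fin.sum_univ_two]
  simp [edgeVector_dart]
  norm_num

theorem edgeVector_dart_ne_zero (e : Fin 4) : edgeVector dart e ≠ 0 := by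
  fin_cases e <;> simp [edgeVector_dart]

theorem mem_supportLine_dart {e : Fin 4} {t : ℝ} {x : Plane} :
    x ∈ supportLine dart dartWeight e t ↔
      cross (edgeVector dart e) (x - dart e) = ‖edgeVector dart e‖ * max 0 (t - dartWeight e) := by
  rw [mem_supportLine_iff (edgeVector_dart_ne_zero e), signedArea_dart,
    Real.sign_of_pos (by norm_num), one_mul]

theorem mem_supportLine_dart_zero {t : ℝ} (ht : 0 ≤ t) {x : Plane} :
    x ∈ supportLine dart dartWeight 0 t ↔ x 1 = t := by
  rw [mem_supportLine_dart, norm_edgeVector_dart_zero]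
  simp [edgeVector_dart, cross_apply, dart_apply, dartWeight, ht]

theorem mem_supportLine_dart_one {t : ℝ} (ht : t ≤ 5) {x : Plane} :
    x ∈ supportLine dart dartWeight 1 t ↔ x 0 + x 1 = 5 := by
  have hcross : cross (edgeVector dart 1) (x - dart 1) = -5 * (x 0 + x 1 - 5) := by
    simp [edgeVector_dart, cross_apply, dart_apply]
    ring
  have hrest : max 0 (t - dartWeight 1) = 0 := max_eq_left (sub_nonpos.2 ht)
  rw [mem_supportLine_dart, hcross, hrest, mul_zero]
  constructor <;> intro h <;> linarith

theorem mem_supportLine_dart_two {t : ℝ} (ht : t ≤ 5) {x : Plane} :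
    x ∈ supportLine dart dartWeight 2 t ↔ x 1 = 2 * x 0 + 5 := by
  have hcross : cross (edgeVector dart 2) (x - dart 2) = 4 * (2 * x 0 + 5 - x 1) := by
    simp [edgeVector_dart, cross_apply, dart_apply]
    ring
  have hrest : max 0 (t - dartWeight 2) = 0 := max_eq_left (sub_nonpos.2 ht)
  rw [mem_supportLine_dart, hcross, hrest, mul_zero]
  constructor <;> intro h <;> linarith

theorem mem_supportLine_dart_three {t : ℝ} {x : Plane} :
    x ∈ supportLine dart dartWeight 3 t ↔ 4 * x 1 - 3 * x 0 = 5 * max 0 (t - 1) := by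
  have hcross : cross (edgeVector dart 3) (x - dart 3) = 4 * x 1 - 3 * x 0 := by
    simp [edgeVector_dart, cross_apply, dart_apply]
    ring
  rw [mem_supportLine_dart, hcross, norm_edgeVector_dart_three]
  rfl

theorem cross_edgeVector_dart_succ_ne_zero (e : Fin 4) :
    cross (edgeVector dart e) (edgeVector dart (e + 1)) ≠ 0 := by
  fin_cases e <;> simp [edgeVector_dart, cross_apply] <;> norm_num

theorem followsSupportLines_dartWavefront :
    FollowsSupportLines dart dartWeight 0 5 dartWavefront := by
  have hspan (e : Fin 4) (x : Plane) :
      x ∈ Submodule.span ℝ {inwardNormal dart e, inwardNormal dart (e + 1)} := by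
    rw [span_inwardNormal_pair_eq_top (by norm_num [signedArea_dart])
      (cross_edgeVector_dart_succ_ne_zero e)]
    exact Submodule.mem_top
  simp only [FollowsSupportLines, dartWavefront, List.rotate_cons_succ, List.rotate_zero,
    List.cons_append, List.nil_append, List.zip_cons_cons, List.zip_nil_left, List.mem_cons,
    List.not_mem_nil, or_false, forall_eq_or_imp, forall_eq]
  refine ⟨fun t ht => ⟨?_, ?_, hspan 0 _⟩, fun t ht => ⟨?_, ?_, hspan 1 _⟩,
    fun t ht => ⟨?_, ?_, hspan 2 _⟩, fun t ht => ⟨?_, ?_, hspan 3 _⟩⟩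
  all_goals
    simp only [mem_supportLine_dart_zero ht.1, mem_supportLine_dart_one ht.2,
      mem_supportLine_dart_two ht.2, mem_supportLine_dart_three,
      Matrix.cons_val_zero, Matrix.cons_val_one]
  all_goals ring

theorem isSimpleChain_dartWavefront {t : ℝ} (ht : t ∈ Ico 0 5) :
    IsSimpleChain (chainAt t dartWavefront) := by
  obtain ⟨h0, h5⟩ := ht
  apply isSimpleChain_quadrilateral <;>
    simp only [cross_apply, PiLp.sub_apply, Matrix.cons_val_zero, Matrix.cons_val_one] <;>
    rcases max_cases 0 (t - 1) with ⟨h, _⟩ | ⟨h, _⟩ <;> rw [h] <;> nlinarith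

theorem isWavefrontUntil_dartWavefront : IsWavefrontUntil dart dartWeight 5 dartWavefront where
  start := by simp [chainAt, dartWavefront, inputChain, List.ofFn_succ, dart_apply]
  followsSupportLines := followsSupportLines_dartWavefront
  isSimpleChain _ := isSimpleChain_dartWavefront

theorem isSimplePolygon_dart : IsSimplePolygon dart := by
  rw [IsSimplePolygon, ← isWavefrontUntil_dartWavefront.start]
  exact isSimpleChain_dartWavefront (by norm_num)

theorem isMoving_dartWavefront {a b v : ℝ} (ha : 0 ≤ a) (hab : a < b) (hb : b ≤ 5)
    (hv : ∀ t ∈ Icc a b, max 0 (t - 1) = max 0 (a - 1) + (t - a) * v) :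
    IsMoving dart dartWeight a b dartWavefront := by
  refine isWavefrontUntil_dartWavefront.isMoving ha hab hb ?_
  simp only [dartWavefront, List.mem_cons, List.not_mem_nil, or_false, forall_eq_or_imp, forall_eq]
  refine ⟨⟨!₂[(4 - 5 * v) / 3, 1], fun t ht => ?_⟩, ⟨!₂[-1, 1], fun t ht => ?_⟩,
    ⟨0, fun t ht => ?_⟩, ⟨!₂[v, 2 * v], fun t ht => ?_⟩⟩
  all_goals apply plane_ext <;> simp [hv t ht] <;> ring

theorem chainAt_five_dartWavefront :
    chainAt 5 dartWavefront = [(0, !₂[0, 5]), (1, !₂[0, 5]), (2, !₂[0, 5]), (3, !₂[0, 5])] := by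
  have hmax : max 0 ((5 : ℝ) - 1) = 4 := by norm_num
  norm_num [chainAt, dartWavefront, hmax]

theorem resolves_nil_of_four_coincident_vertices {a b c d : Fin n} {p : Plane} :
    Resolves [[(a, p), (b, p), (c, p), (d, p)]] [] :=
  .cutAtVertex (X := []) (List.IsRotated.refl _) (.remove (by simp)
    (.cutAtVertex (X := []) (List.IsRotated.refl _) (.remove (by simp)
      (.remove (by simp) .nil))))

/-- The propagation of `dart`; its two phases meet at time `1`, when edge `3` starts to move. -/
noncomputable def dartPropagation : Propagation dart dartWeight where
  steps := 2
  time k := if k = 0 then 0 else if k = 1 then 1 else 5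
  phase k := if k < 2 then [dartWavefront] else []
  time_zero := rfl
  time_lt k hk := by interval_cases k <;> norm_num
  start := by simp [isWavefrontUntil_dartWavefront.start]
  moving k hk m hm := by
    obtain rfl : m = dartWavefront := by simpa [hk] using hm
    interval_cases k
    · refine isMoving_dartWavefront (v := 0) (by simp) (by simp) (by norm_num) ?_
      simp
    · refine isMoving_dartWavefront (v := 1) (by simp) (by norm_num) (by norm_num) ?_
      simp +contextual
  resolves k hk := by
    interval_cases k
    · simpa using .keep (isSimpleChain_dartWavefront (t := 1) (by norm_num)) .nil
    · simpa [chainAt_five_dartWavefront] using resolves_nil_of_four_coincident_vertices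
  collapsed := rfl

theorem mem_fragments_dart_zero {W : Propagation dart dartWeight} {t : ℝ} (h0 : 0 ≤ t)
    (h5 : t < 5) {x : Plane} :
    x ∈ W.fragments 0 t ↔
      x 0 ∈ Icc ((4 * t - 5 * max 0 (t - 1)) / 3) (5 - t) ∧ x 1 = t := by
  have hle : (4 * t - 5 * max 0 (t - 1)) / 3 ≤ 5 - t := by
    rcases max_cases 0 (t - 1) with h | h <;> linarith
  rw [Propagation.mem_fragments_iff isWavefrontUntil_dartWavefront h0 h5]
  simp [chainEdges, chainAt, dartWavefront, segment_horizontal hle]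

theorem not_isMonotoneWrt_face_dart_zero (W : Propagation dart dartWeight) :
    ¬ IsMonotoneWrt (W.face 0) (edgeVector dart 0) := by
  have hperp (y : Plane) : inner ℝ (y - !₂[1, 0]) (edgeVector dart 0) = 0 ↔ y 0 = 1 := by
    simp [edgeVector_dart, PiLp.inner_apply, Fin.sum_univ_two, sub_eq_zero]
  refine W.not_isMonotoneWrt_face (x := !₂[1, 0]) (s := 0) (t := 1) (u := 2)
    (by norm_num [signedArea_dart]) (edgeVector_dart_ne_zero 0) zero_le_one one_le_two
    (by simp [dartWeight]) ⟨!₂[1, 0], ?_⟩ ?_ ⟨!₂[1, 2], ?_⟩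
  · rw [mem_inter_iff, mem_fragments_dart_zero le_rfl (by norm_num), mem_ofPred_eq, hperp]
    norm_num
  · refine eq_empty_of_forall_notMem fun y ⟨hy, hy0⟩ => ?_
    rw [mem_fragments_dart_zero zero_le_one (by norm_num)] at hy
    have hy1 := hy.1.1
    rw [(hperp y).1 hy0] at hy1
    norm_num at hy1
  · rw [mem_inter_iff, mem_fragments_dart_zero zero_le_two (by norm_num), mem_ofPred_eq, hperp]
    norm_num

end StraightSkeleton

/-- Some face of the additively-weighted straight skeleton of some simple polygon is not monotone
with respect to the edge that emanated it. The propagation process of the witness exists, and the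
claim holds for the face as given by any such process. -/
theorem mainTheorem7 :
    ∃ (n : ℕ) (P : Polygon StraightSkeleton.Plane n) (δ : Fin n → ℝ) (e : Fin n),
      StraightSkeleton.IsSimplePolygon P ∧
      (∀ i, 0 ≤ δ i) ∧
      Nonempty (StraightSkeleton.Propagation P δ) ∧
      ∀ W : StraightSkeleton.Propagation P δ,
        ¬ StraightSkeleton.IsMonotoneWrt (W.face e) (StraightSkeleton.edgeVector P e) := by
  refine ⟨4, StraightSkeleton.dart, StraightSkeleton.dartWeight, 0,
    StraightSkeleton.isSimplePolygon_dart, fun i => ?_, ⟨StraightSkeleton.dartPropagation⟩,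
    StraightSkeleton.not_isMonotoneWrt_face_dart_zero⟩
  fin_cases i <;> simp [StraightSkeleton.dartWeight]
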